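/- Let $M$ be a connected smooth manifold (Hausdorff, second countable) of dimension $n\ge 1$ with non-empty boundary, and let $g$ be a smooth Riemannian metric on $M$. Let $\mathsf{D}M=M\cup_{\partial M}M$ be the topological double of $M$, equipped with the smooth structure induced by the geodesic collar $\varrho_g(t,p)=\exp_p(tN_g(p))$ of $g$, where $N_g$ is the inward-pointing unit normal field along $\partial M$. That is, the interiors of the two copies of $M$ keep their smooth structure, and the doubled collar, sending $(t,p)$ to $\varrho_g(t,p)$ in the first copy for $t\ge 0$ and to $\varrho_g(-t,p)$ in the second copy for $t\le 0$, is a diffeomorphism from an open neighbourhood of $\{0\}\times\partial M$ in $\mathbb{R}\times\partial M$ onto an open subset of $\mathsf{D}M$. Suppose that $g$ is a doubling metric, i.e. that the twofold copy $g\cup g$ is a smooth Riemannian metric on $\mathsf{D}M$; this means that there is a smooth Riemannian metric $G$ on $\mathsf{D}M$ which restricts to $g$ on both copies of $M$. If $g$ is complete, i.e. if every sequence in $M$ which is Cauchy with respect to the Riemannian distance $d_g$ converges with respect to $d_g$, then $G=g\cup g$ (the unique smooth Riemannian metric on $\mathsf{D}M$ restricting to $g$ on both copies) is complete, i.e. every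 $d_G$-Cauchy sequence in $\mathsf{D}M$ converges with respect to $d_G$. -/

import Mathlib

open Set Filter Topology Manifold Bundle
open scoped ENNReal ContDiff

noncomputable section

/-- Smooth Riemannian metrics on a smooth manifold `M` (possibly with boundary). -/
abbrev SmoothRiemannianMetric {E H : Type*} [NormedAddCommGroup E] [NormedSpace ℝ E]
    [TopologicalSpace H] (I : ModelWithCorners ℝ E H) (M : Type*) [TopologicalSpace M]
    [ChartedSpace H M] [IsManifold I ∞ M] :=
  ContMDiffRiemannianMetric I ∞ E (fun x : M => TangentSpace I x)

namespace SmoothRiemannianMetric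

variable {E H M : Type*} [NormedAddCommGroup E] [NormedSpace ℝ E] [TopologicalSpace H]
  {I : ModelWithCorners ℝ E H} [TopologicalSpace M] [ChartedSpace H M] [IsManifold I ∞ M]

/-- The Riemannian distance of `g`: the infimum of the `g`-lengths of `C^1` curves in `M`
joining the two points. -/
def riemDist (g : SmoothRiemannianMetric I M) (x y : M) : ℝ≥0∞ :=
  letI : RiemannianBundle (fun x : M => TangentSpace I x) := ⟨g.toRiemannianMetric⟩
  riemannianEDist I x y

/-- Metric completeness: every sequence which is Cauchy for the Riemannian distance converges
for the Riemannian distance. -/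
def IsComplete (g : SmoothRiemannianMetric I M) : Prop :=
  ∀ u : ℕ → M,
    (∀ ε : ℝ≥0∞, 0 < ε → ∃ N : ℕ, ∀ k ≥ N, ∀ l ≥ N, g.riemDist (u k) (u l) < ε) →
    ∃ x : M, Tendsto (fun k => g.riemDist (u k) x) atTop (𝓝 0)

/-- The coefficients of `g` in the preferred chart at `p`, at the coordinate point `x`. -/
def coordMetric (g : SmoothRiemannianMetric I M) (p : M) (x v w : E) : ℝ :=
  g.inner ((extChartAt I p).symm x)
    (mfderivWithin 𝓘(ℝ, E) I (extChartAt I p).symm (range I) x v)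
    (mfderivWithin 𝓘(ℝ, E) I (extChartAt I p).symm (range I) x w)

/-- `γ` is a (smooth, affinely parametrised) `g`-geodesic on the interval `s`. At each time the
geodesic equation is written in the chart at the current point, with the index lowered by `g`:
with velocity `v` and acceleration `a` of the coordinate expression `u` of `γ`,
`g(a, w) + ∂_v g(v, w) - (1/2) ∂_w g(v, v) = 0` for all `w`, the last two terms being
the Christoffel symbols of the first kind, applied to `(v, v, w)`. -/
def IsGeodesicOn (g : SmoothRiemannianMetric I M) (γ : ℝ → M) (s : Set ℝ) : Prop :=
  ContMDiffOn 𝓘(ℝ, ℝ) I ∞ γ s ∧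
  ∀ t ∈ s, ∀ w : E,
    let u : ℝ → E := fun r => extChartAt I (γ t) (γ r)
    let v : E := derivWithin u s t
    let a : E := derivWithin (derivWithin u s) s t
    g.coordMetric (γ t) (u t) a w
      + fderivWithin ℝ (fun x => g.coordMetric (γ t) x v w) (range I) (u t) v
      - (1 / 2) * fderivWithin ℝ (fun x => g.coordMetric (γ t) x v v) (range I) (u t) w = 0

end SmoothRiemannianMetric

section Double

variable (n : ℕ) [NeZero n] (M : Type*) [TopologicalSpace M] [ChartedSpace (EuclideanHalfSpace n) M]

/-- Two points of `Bool × M` (two disjoint copies of `M`) are identified iff they are equal or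
they are the two copies of the same boundary point. -/
def doubleSetoid : Setoid (Bool × M) where
  r a b := a.2 = b.2 ∧ (a.1 = b.1 ∨ a.2 ∈ (𝓡∂ n).boundary M)
  iseqv :=
    { refl := fun _ => ⟨rfl, Or.inl rfl⟩
      symm := fun h => ⟨h.1.symm, h.2.imp Eq.symm (fun hb => h.1 ▸ hb)⟩
      trans := fun h h' => ⟨h.1.trans h'.1, by
        rcases h.2 with h2 | h2
        · rcases h'.2 with h3 | h3
          · exact Or.inl (h2.trans h3)
          · exact Or.inr (h.1.symm ▸ h3)
        · exact Or.inr h2⟩ }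

/-- The topological double `M ∪_{∂M} M`, with the quotient topology. -/
def Double : Type _ := Quotient (doubleSetoid n M)

instance : TopologicalSpace (Double n M) :=
  inferInstanceAs (TopologicalSpace (Quotient (doubleSetoid n M)))

end Double

section GeodesicDouble

variable {n : ℕ} [NeZero n] {M : Type*} [TopologicalSpace M]
  [ChartedSpace (EuclideanHalfSpace n) M]

/-- The inclusion of the first (`k = false`) or second (`k = true`) copy of `M`. -/
def Double.incl (k : Bool) (p : M) : Double n M := Quotient.mk (doubleSetoid n M) (k, p)

/-- Replace the coordinate `x_1` of a point of `ℝⁿ` (the coordinate indexed by `0`) by `s`. -/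
def setFirst (s : ℝ) (x : EuclideanSpace ℝ (Fin n)) : EuclideanSpace ℝ (Fin n) :=
  WithLp.toLp 2 (Function.update (fun i => x i) 0 s)

/-- The reflection `(x_1, x') ↦ (-x_1, x')` of `ℝⁿ`. -/
def reflectFirst (x : EuclideanSpace ℝ (Fin n)) : EuclideanSpace ℝ (Fin n) :=
  setFirst (-(x 0)) x

variable [IsManifold (𝓡∂ n) ∞ M]

/-- `v` is the inward-pointing unit normal `N_g(p)` at the boundary point `p`. In the chart at `p`,
the vectors tangent to the boundary are those with vanishing first coordinate, and the
inward-pointing ones are those with positive first coordinate. -/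
def IsInwardUnitNormal (g : SmoothRiemannianMetric (𝓡∂ n) M) (p : M)
    (v : TangentSpace (𝓡∂ n) p) : Prop :=
  let D : TangentSpace (𝓡∂ n) p → EuclideanSpace ℝ (Fin n) :=
    fun w => mfderiv (𝓡∂ n) 𝓘(ℝ, EuclideanSpace ℝ (Fin n)) (extChartAt (𝓡∂ n) p) p w
  p ∈ (𝓡∂ n).boundary M ∧ 0 < D v 0 ∧ g.inner p v v = 1 ∧
    ∀ w : TangentSpace (𝓡∂ n) p, D w 0 = 0 → g.inner p v w = 0

/-- `γ` restricted to `[0, b]` is the curve `t ↦ exp_p(t N_g(p))` for the boundary point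
`p = γ 0`. -/
def IsNormalGeodesic (g : SmoothRiemannianMetric (𝓡∂ n) M) (γ : ℝ → M) (b : ℝ) : Prop :=
  g.IsGeodesicOn γ (Icc 0 b) ∧
  IsInwardUnitNormal g (γ 0) (mfderivWithin 𝓘(ℝ, ℝ) (𝓡∂ n) γ (Icc 0 b) 0 (1 : ℝ))

/-- `φ` is a smooth chart of `M` given by the geodesic collar `ϱ_g(t, p) = exp_p(t N_g(p))`:
`φ (ϱ_g(t, p)) = (t, ψ p)`, where `ψ` is the chart of `∂M` obtained by restricting `φ`.
With each point of its image, it contains the segment to the boundary in the first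
coordinate direction; this segment is the coordinate expression of the
normal geodesic `t ↦ exp_p(t N_g(p))`. -/
def IsGeodesicCollarChart (g : SmoothRiemannianMetric (𝓡∂ n) M)
    (φ : OpenPartialHomeomorph M (EuclideanHalfSpace n)) : Prop :=
  φ ∈ IsManifold.maximalAtlas (𝓡∂ n) ∞ M ∧
  ∀ x ∈ (φ.extend (𝓡∂ n)).target, 0 < x 0 →
    (∀ s ∈ Icc 0 (x 0), setFirst s x ∈ (φ.extend (𝓡∂ n)).target) ∧
    IsNormalGeodesic g (fun s => (φ.extend (𝓡∂ n)).symm (setFirst s x)) (x 0)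

/-- The atlas of the smooth double `DM^g`. It consists of
* the smooth charts of the interior of `M`, on either of the two copies;
* the twofold copies of the charts given by the geodesic collar, with the second copy reflected:
  in terms of the doubled collar on an open subset of `ℝ × ∂M`, these are `(t, p) ↦ (t, ψ p)`
  with charts `ψ` of `∂M`. -/
def geodesicDoubleAtlas (g : SmoothRiemannianMetric (𝓡∂ n) M) :
    Set (OpenPartialHomeomorph (Double n M) (EuclideanSpace ℝ (Fin n))) :=
  {e | ∃ k : Bool, ∃ φ ∈ IsManifold.maximalAtlas (𝓡∂ n) ∞ M,
      φ.source ⊆ (𝓡∂ n).interior M ∧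
      e.source = Double.incl k '' φ.source ∧
      ∀ p ∈ φ.source, e (Double.incl k p) = φ.extend (𝓡∂ n) p} ∪
  {e | ∃ φ, IsGeodesicCollarChart g φ ∧
      e.source = Double.incl false '' φ.source ∪ Double.incl true '' φ.source ∧
      ∀ p ∈ φ.source,
        e (Double.incl false p) = φ.extend (𝓡∂ n) p ∧
        e (Double.incl true p) = reflectFirst (φ.extend (𝓡∂ n) p)}

/-- The smooth structure on the topological double is that of `DM^g`, i.e. the smooth structure
which is induced by the geodesic collar of `g`. -/
structure IsGeodesicDouble (g : SmoothRiemannianMetric (𝓡∂ n) M)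
    [ChartedSpace (EuclideanSpace ℝ (Fin n)) (Double n M)] : Prop where
  atlas_eq : atlas (EuclideanSpace ℝ (Fin n)) (Double n M) = geodesicDoubleAtlas g

variable [ChartedSpace (EuclideanSpace ℝ (Fin n)) (Double n M)] [IsManifold (𝓡 n) ∞ (Double n M)]

/-- The smooth metric `G` on the double is the twofold copy `g ∪ g`: it restricts to `g` on both
copies of `M`. -/
def IsTwofoldCopy (g : SmoothRiemannianMetric (𝓡∂ n) M)
    (G : SmoothRiemannianMetric (𝓡 n) (Double n M)) : Prop :=
  ∀ (k : Bool) (p : M) (v w : TangentSpace (𝓡∂ n) p),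
    G.inner (Double.incl k p)
      (mfderiv (𝓡∂ n) (𝓡 n) (Double.incl k : M → Double n M) p v)
      (mfderiv (𝓡∂ n) (𝓡 n) (Double.incl k : M → Double n M) p w) = g.inner p v w

/-- `g` is a doubling metric: the twofold copy `g ∪ g` is a smooth Riemannian metric on `DM^g`
(it is used with the smooth structure of `DM^g` on the double). -/
def IsDoublingMetric (g : SmoothRiemannianMetric (𝓡∂ n) M) : Prop :=
  ∃ G : SmoothRiemannianMetric (𝓡 n) (Double n M), IsTwofoldCopy g G

end GeodesicDouble

end

/-! The fold map `DM → M`, which forgets the copy, and both inclusions `M → DM` do not increase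
distances. Hence a `d_G`-Cauchy sequence folds to a `d_g`-Cauchy sequence, with a limit `p`. One
copy of `M` contains infinitely many terms; the inclusion of that copy turns convergence of their
folds to `p` into convergence of these terms to the copy of `p`, and a Cauchy sequence with a
convergent subsequence converges.

The work is in `riemDist_fold_le`. The fold map is differentiable only along each copy, and a `C^1`
curve may cross the boundary infinitely often, so its folded image need not be even piecewise `C^1`
and has no usable length. `riemannianEDist_le_of_piecewise_norm_le` instead bounds the distance
travelled by the image pointwise in time, by induction along the interval. Uniqueness of `G` holds
since the derivatives of the inclusions are surjective. -/

/-! ### Riemannian distance near a point, in a chart. -/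

section RiemannianDistance

variable {E : Type*} [NormedAddCommGroup E] [NormedSpace ℝ E]
  {H : Type*} [TopologicalSpace H] (I : ModelWithCorners ℝ E H)
  {M : Type*} [TopologicalSpace M] [ChartedSpace H M]
  [RiemannianBundle (fun x : M => TangentSpace I x)]
  [IsManifold I 1 M] [IsContinuousRiemannianBundle E (fun x : M => TangentSpace I x)]

/-- By continuity of the metric: at `y = x` the map in question is the identity of the tangent
space, so nearby its norm is below any `r > 1`. -/
lemma eventually_norm_mfderivWithin_extChartAt_symm_comp_le (x : M) {r : ℝ} (hr : 1 < r) :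
    ∀ᶠ y in 𝓝 x, ∀ v : TangentSpace I x,
      ‖mfderiv[range I] (extChartAt I x).symm (extChartAt I x y) v‖ ≤ r * ‖v‖ := by
  have hx : (chartAt H x).source ∈ 𝓝 x := chart_source_mem_nhds H x
  filter_upwards [eventually_norm_symmL_trivializationAt_comp_self_lt E
    (fun x : M => TangentSpace I x) x hr, hx] with y hy h'y v
  have A : (extChartAt I x).symm (extChartAt I x y) = y :=
    (extChartAt I x).left_inv (by simpa using h'y)
  have key : ‖(trivializationAt E (fun x : M => TangentSpace I x) x).symmL ℝ y v‖ ≤ r * ‖v‖ := by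
    have := (ContinuousLinearMap.le_opNorm _ v).trans
      (mul_le_mul_of_nonneg_right hy.le (norm_nonneg v))
    rw [TangentBundle.continuousLinearMapAt_trivializationAt (mem_chart_source H x),
      mfderiv_extChartAt_self] at this
    exact this
  rw [TangentBundle.symmL_trivializationAt h'y] at key
  convert! key using 2; congr

lemma eventually_norm_mfderivWithin_extChartAt_symm_le (x : M) {r : ℝ} (hr : 1 < r) :
    ∀ᶠ z in 𝓝[range I] (extChartAt I x x), ∀ v : TangentSpace I x,
      ‖mfderiv[range I] (extChartAt I x).symm z v‖ ≤ r * ‖v‖ := by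
  have hC := eventually_norm_mfderivWithin_extChartAt_symm_comp_le I x hr
  have : 𝓝 x = 𝓝 ((extChartAt I x).symm (extChartAt I x x)) := by simp
  rw [this] at hC
  have : ContinuousAt (extChartAt I x).symm (extChartAt I x x) := continuousAt_extChartAt_symm _
  filter_upwards [nhdsWithin_le_nhds (this.eventually hC),
    extChartAt_target_mem_nhdsWithin x] with y hy h'y
  have : y = (extChartAt I x) ((extChartAt I x).symm y) := by simp [-extChartAt, h'y]
  rw [← this] at hy
  exact hy

/-- The difference of the coordinates of `y` and `x` in the preferred chart at `x`, as a tangent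
vector at `x`. -/
noncomputable def extChartSub (x y : M) : TangentSpace I x :=
  (extChartAt I x y - extChartAt I x x : E)

/-- The Riemannian distance to a nearby point is controlled, up to a factor arbitrarily close to
`1`, by the norm in the tangent space of the difference vector in the extended chart. -/
lemma eventually_riemannianEDist_le_enorm_extChartAt_sub (x : M) {r : ℝ} (hr : 1 < r) :
    ∀ᶠ y in 𝓝 x, riemannianEDist I x y ≤
      ENNReal.ofReal (r * ‖extChartSub I x y‖) := by
  obtain ⟨ρ, ρ_pos, hρ⟩ : ∃ ρ > 0,
      Metric.ball (extChartAt I x x) ρ ∩ range I ⊆ (extChartAt I x).target ∩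
        {z | ∀ v : TangentSpace I x,
          ‖mfderiv[range I] (extChartAt I x).symm z v‖ ≤ r * ‖v‖} :=
    Metric.mem_nhdsWithin_iff.1 (inter_mem (extChartAt_target_mem_nhdsWithin x)
      (eventually_norm_mfderivWithin_extChartAt_symm_le I x hr))
  have A : (extChartAt I x) ⁻¹' (Metric.ball (extChartAt I x x) ρ ∩ range I) ∈ 𝓝 x := by
    apply extChartAt_preimage_mem_nhds_of_mem_nhdsWithin (by simp)
    rw [inter_comm]
    exact inter_mem_nhdsWithin _ (Metric.ball_mem_nhds _ ρ_pos)
  filter_upwards [A, chart_source_mem_nhds H x] with y hy h'y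
  -- The competing curve is the coordinate segment from `x` to `y`. It stays in the chart because
  -- the ball and `range I` are both convex, which also covers boundary points.
  let η := ContinuousAffineMap.lineMap (R := ℝ) (extChartAt I x x) (extChartAt I x y)
  set γ := (extChartAt I x).symm ∘ η
  have hη : Icc 0 1 ⊆ ⇑η ⁻¹' ((extChartAt I x).target ∩
        {z | ∀ v : TangentSpace I x,
          ‖mfderiv[range I] (extChartAt I x).symm z v‖ ≤ r * ‖v‖}) := by
    simp only [← image_subset_iff, ContinuousAffineMap.coe_lineMap_eq,
     ← segment_eq_image_lineMap, η]
    apply Subset.trans _ hρ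
    exact ((convex_ball _ _).inter I.convex_range).segment_subset (by simp [ρ_pos]) hy
  simp only [preimage_inter, subset_inter_iff] at hη
  have η_smooth : CMDiff[Icc 0 1] 1 η := by
    apply ContMDiff.contMDiffOn
    rw [contMDiff_iff_contDiff]
    exact ContinuousAffineMap.contDiff _
  have : riemannianEDist I x y ≤ pathELength I γ 0 1 := by
    apply riemannianEDist_le_pathELength _ _ _ zero_le_one
    · exact (contMDiffOn_extChartAt_symm x).comp η_smooth hη.1
    · simp [γ, η, ContinuousAffineMap.coe_lineMap_eq]
    · simp [γ, η, ContinuousAffineMap.coe_lineMap_eq, h'y]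
  apply this.trans
  rw [pathELength_eq_lintegral_mfderivWithin_Icc]
  have hc : ENNReal.ofReal (r * ‖extChartSub I x y‖) =
      ∫⁻ _ in Icc (0 : ℝ) 1,
        ENNReal.ofReal (r * ‖extChartSub I x y‖) := by
    simp
  rw [hc]
  apply MeasureTheory.setLIntegral_mono' measurableSet_Icc (fun t ht ↦ ?_)
  have h1 : mfderiv[Icc 0 1] γ t =
      (mfderiv[range I] (extChartAt I x).symm (η t)) ∘L (mfderiv[Icc 0 1] η t) := by
    apply mfderivWithin_comp
    · exact mdifferentiableWithinAt_extChartAt_symm (hη.1 ht)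
    · exact η_smooth.mdifferentiableOn one_ne_zero t ht
    · exact hη.1.trans (preimage_mono (extChartAt_target_subset_range x))
    · rw [uniqueMDiffWithinAt_iff_uniqueDiffWithinAt]
      exact uniqueDiffOn_Icc zero_lt_one t ht
  have h2 : mfderiv[Icc 0 1] γ t 1 =
      (mfderiv[range I] (extChartAt I x).symm (η t)) (mfderiv[Icc 0 1] η t 1) := congr($h1 1)
  have h3 : mfderiv[Icc 0 1] η t 1 = extChartAt I x y - extChartAt I x x := by
    simp only [mfderivWithin_eq_fderivWithin]
    rw [fderivWithin_eq_fderiv (uniqueDiffOn_Icc zero_lt_one _ ht)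
      (ContinuousAffineMap.differentiableAt _)]
    exact (by simp [η] : fderiv ℝ η t 1 = extChartAt I x y - extChartAt I x x)
  rw [h2, h3, ← ofReal_norm]
  exact ENNReal.ofReal_le_ofReal (hη.2 ht (extChartSub I x y))

end RiemannianDistance

/-! ### Speed, length and displacement of curves. -/

section RiemannianDistanceCurves

variable {E : Type*} [NormedAddCommGroup E] [NormedSpace ℝ E]
  {H : Type*} [TopologicalSpace H] {I : ModelWithCorners ℝ E H}
  {M : Type*} [TopologicalSpace M] [ChartedSpace H M]
  [RiemannianBundle (fun x : M => TangentSpace I x)]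

lemma pathELength_eq_setLIntegral_ofReal_norm {γ : ℝ → M} {a b t s : ℝ} (hat : a ≤ t)
    (hsb : s ≤ b) : pathELength I γ t s =
      ∫⁻ r in Ioo t s, ENNReal.ofReal ‖mfderiv[Icc a b] γ r (1 : ℝ)‖ := by
  rw [pathELength_eq_lintegral_mfderiv_Ioo]
  refine MeasureTheory.setLIntegral_congr_fun measurableSet_Ioo fun r hr => ?_
  have : Icc a b ∈ 𝓝 r := Icc_mem_nhds (hat.trans_lt hr.1) (hr.2.trans_le hsb)
  rw [mfderivWithin_of_mem_nhds this]
  exact (ofReal_norm _).symm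

variable [IsManifold I 1 M] [IsContinuousRiemannianBundle E (fun x : M => TangentSpace I x)]

/-- A curve which is differentiable at `t` within `S` moves at most with its speed at `t`, up to an
arbitrarily small error. -/
lemma HasMFDerivWithinAt.eventually_riemannianEDist_le {c : ℝ → M} {S : Set ℝ} {t : ℝ}
    {c' : TangentSpace 𝓘(ℝ, ℝ) t →L[ℝ] TangentSpace I (c t)}
    (hc : HasMFDerivWithinAt 𝓘(ℝ, ℝ) I c S t c') {δ : ℝ} (hδ : ‖c' (1 : ℝ)‖ < δ) :
    ∀ᶠ s in 𝓝[S] t, riemannianEDist I (c t) (c s) ≤ ENNReal.ofReal (δ * |s - t|) := by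
  -- `δ` is split as `(δ / δ') * δ'`: the first factor, above `1`, absorbs the distortion of the
  -- chart, and `δ'` bounds the difference quotient.
  obtain ⟨δ', hδ', hδ'δ⟩ := exists_between hδ
  have hpos : 0 < δ' := (norm_nonneg _).trans_lt hδ'
  have hr : 1 < δ / δ' := by rwa [one_lt_div hpos]
  let D : ℝ →L[ℝ] E := c'
  have hF : HasFDerivWithinAt (fun s => extChartAt I (c t) (c s)) D S t := by
    have := hc.2
    simp only [mfld_simps, writtenInExtChartAt] at this
    exact this
  have hD := hF.hasDerivWithinAt
  rw [hasDerivWithinAt_iff_tendsto_slope] at hD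
  have hcont : Continuous (fun v : TangentSpace I (c t) => ‖v‖) := continuous_norm
  -- The `id` reads the slope, a vector of `E`, as a tangent vector at `c t`, so that the norm is
  -- the Riemannian one.
  have hev : ∀ᶠ s in 𝓝[S \ {t}] t,
      ‖(id (slope (fun s => extChartAt I (c t) (c s)) t s) : TangentSpace I (c t))‖ < δ' :=
    ((hcont.tendsto _).comp hD).eventually (gt_mem_nhds hδ')
  rw [eventually_nhdsWithin_iff] at hev
  filter_upwards [nhdsWithin_le_nhds hev, self_mem_nhdsWithin,
    hc.1.eventually (eventually_riemannianEDist_le_enorm_extChartAt_sub I (c t) hr)]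
    with s hs hsS hdist
  rcases eq_or_ne s t with rfl | hst
  · simp [riemannianEDist_self]
  refine hdist.trans (ENNReal.ofReal_le_ofReal ?_)
  have hsub : extChartSub I (c t) (c s) =
      (s - t) • (id (slope (fun s => extChartAt I (c t) (c s)) t s) : TangentSpace I (c t)) :=
    (sub_smul_slope (fun s => extChartAt I (c t) (c s)) t s).symm
  rw [hsub, norm_smul, Real.norm_eq_abs]
  calc δ / δ' * (|s - t| * _) ≤ δ / δ' * (|s - t| * δ') := by
        gcongr
        exact (hs ⟨hsS, hst⟩).le
    _ = δ * |s - t| := by field_simp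

/-- The speed of a `C^1` curve is continuous. -/
lemma ContMDiffOn.continuousOn_norm_mfderivWithin_Icc {γ : ℝ → M} {a b : ℝ} (hab : a < b)
    (hγ : ContMDiffOn 𝓘(ℝ, ℝ) I 1 γ (Icc a b)) :
    ContinuousOn (fun s => ‖mfderiv[Icc a b] γ s (1 : ℝ)‖) (Icc a b) := by
  have h1 : ContinuousOn (tangentMapWithin 𝓘(ℝ, ℝ) I γ (Icc a b)) (TotalSpace.proj ⁻¹' Icc a b) :=
    hγ.continuousOn_tangentMapWithin le_rfl (uniqueDiffOn_Icc hab).uniqueMDiffOn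
  have h2 : Continuous (fun s : ℝ => (⟨s, (1 : ℝ)⟩ : TangentBundle 𝓘(ℝ, ℝ) ℝ)) := by
    have h : Continuous fun s : ℝ => ((s, (1 : ℝ)) : ModelProd ℝ ℝ) :=
      continuous_id.prodMk continuous_const
    exact (tangentBundleModelSpaceHomeomorph 𝓘(ℝ, ℝ)).symm.continuous.comp h
  have h3 : ContinuousOn (fun s => (⟨γ s, mfderiv[Icc a b] γ s (1 : ℝ)⟩ : TangentBundle I M))
      (Icc a b) := h1.comp h2.continuousOn (fun s hs => hs)
  have h4 := h3.inner_bundle h3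
  simp only [norm_eq_sqrt_real_inner]
  exact h4.sqrt

/-- This allows pointwise bounds on the speed to be integrated from `t` to `s`. For `s ≤ t` the
interval is empty, and the length estimates below read `0 ≤ 0`. -/
lemma eventually_forall_Ioo_of_eventually_nhdsWithin_Icc {a b t : ℝ} (ht : t ∈ Icc a b)
    {p : ℝ → Prop} (hp : ∀ᶠ s in 𝓝[Icc a b] t, p s) :
    ∀ᶠ s in 𝓝[Icc a b] t, ∀ r ∈ Ioo t s, p r := by
  obtain ⟨ρ, ρ_pos, hρ⟩ := Metric.mem_nhdsWithin_iff.1 hp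
  filter_upwards [nhdsWithin_le_nhds (Metric.ball_mem_nhds t ρ_pos), self_mem_nhdsWithin]
    with s hs hs' r hr
  refine hρ ⟨?_, ht.1.trans hr.1.le, hr.2.le.trans hs'.2⟩
  rw [Metric.mem_ball, Real.dist_eq, abs_lt] at hs ⊢
  constructor <;> linarith [hr.1, hr.2]

/-- A short piece of a `C^1` curve is at most as long as the speed times the elapsed time, up to an
arbitrarily small error. -/
lemma ContMDiffOn.eventually_pathELength_le {γ : ℝ → M} {a b : ℝ} (hab : a < b)
    (hγ : ContMDiffOn 𝓘(ℝ, ℝ) I 1 γ (Icc a b)) {t : ℝ} (ht : t ∈ Icc a b) {δ : ℝ}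
    (hδ : ‖mfderiv[Icc a b] γ t (1 : ℝ)‖ < δ) :
    ∀ᶠ s in 𝓝[Icc a b] t,
      pathELength I γ t s ≤ ENNReal.ofReal δ * ENNReal.ofReal (s - t) := by
  have := (hγ.continuousOn_norm_mfderivWithin_Icc hab t ht).eventually (gt_mem_nhds hδ)
  filter_upwards [eventually_forall_Ioo_of_eventually_nhdsWithin_Icc ht this,
    self_mem_nhdsWithin] with s hs hsab
  rw [pathELength_eq_setLIntegral_ofReal_norm ht.1 hsab.2, ← Real.volume_Ioo,
    ← MeasureTheory.setLIntegral_const]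
  exact MeasureTheory.setLIntegral_mono' measurableSet_Ioo
    fun r hr => ENNReal.ofReal_le_ofReal (hs r hr).le

/-- A short piece of a `C^1` curve is at least as long as the speed times the elapsed time, up to an
arbitrarily small error. -/
lemma ContMDiffOn.eventually_le_pathELength {γ : ℝ → M} {a b : ℝ} (hab : a < b)
    (hγ : ContMDiffOn 𝓘(ℝ, ℝ) I 1 γ (Icc a b)) {t : ℝ} (ht : t ∈ Icc a b) {δ : ℝ}
    (hδ : δ < ‖mfderiv[Icc a b] γ t (1 : ℝ)‖) :
    ∀ᶠ s in 𝓝[Icc a b] t,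
      ENNReal.ofReal δ * ENNReal.ofReal (s - t) ≤ pathELength I γ t s := by
  have := (hγ.continuousOn_norm_mfderivWithin_Icc hab t ht).eventually (lt_mem_nhds hδ)
  filter_upwards [eventually_forall_Ioo_of_eventually_nhdsWithin_Icc ht this,
    self_mem_nhdsWithin] with s hs hsab
  rw [pathELength_eq_setLIntegral_ofReal_norm ht.1 hsab.2, ← Real.volume_Ioo,
    ← MeasureTheory.setLIntegral_const]
  exact MeasureTheory.setLIntegral_mono' measurableSet_Ioo
    fun r hr => ENNReal.ofReal_le_ofReal (hs r hr).le

/-! ### Piecewise differentiable maps do not increase distances. -/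

section Lipschitz

variable {E' : Type*} [NormedAddCommGroup E'] [NormedSpace ℝ E']
  {H' : Type*} [TopologicalSpace H'] {J : ModelWithCorners ℝ E' H'}
  {N : Type*} [TopologicalSpace N] [ChartedSpace H' N]
  [RiemannianBundle (fun x : N => TangentSpace J x)]
  {ι : Type*} [Finite ι] {S : ι → Set N} {F : N → M}

/-- A map which is differentiable along each of finitely many pieces of its domain, with derivatives
not increasing norms, moves along a `C^1` curve at most with the speed of the curve. -/
lemma eventually_riemannianEDist_comp_le
    (hF : ∀ i, ∀ x ∈ S i, ∃ A : TangentSpace J x →L[ℝ] TangentSpace I (F x),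
      HasMFDerivWithinAt J I F (S i) x A ∧ ∀ v, ‖A v‖ ≤ ‖v‖)
    (hS : ∀ x, ∀ᶠ y in 𝓝 x, ∃ i, x ∈ S i ∧ y ∈ S i)
    {γ : ℝ → N} {U : Set ℝ} {t : ℝ} {γ' : TangentSpace 𝓘(ℝ, ℝ) t →L[ℝ] TangentSpace J (γ t)}
    (hγ : HasMFDerivWithinAt 𝓘(ℝ, ℝ) J γ U t γ') {δ : ℝ} (hδ : ‖γ' (1 : ℝ)‖ < δ) :
    ∀ᶠ s in 𝓝[U] t, riemannianEDist I (F (γ t)) (F (γ s)) ≤ ENNReal.ofReal (δ * |s - t|) := by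
  -- The piece shared by `γ t` and `γ s` depends on `s`, so the estimate is needed for all pieces at
  -- once; this is where finiteness of `ι` enters. On each piece the chain rule applies within `γ
  -- ⁻¹' S i`.
  have key : ∀ᶠ s in 𝓝[U] t, ∀ i, γ t ∈ S i → γ s ∈ S i →
      riemannianEDist I (F (γ t)) (F (γ s)) ≤ ENNReal.ofReal (δ * |s - t|) := by
    rw [eventually_all]
    intro i
    by_cases hi : γ t ∈ S i
    swap
    · exact Eventually.of_forall fun s h => absurd h hi
    obtain ⟨A, hA, hA'⟩ := hF i (γ t) hi
    have h1 : HasMFDerivWithinAt 𝓘(ℝ, ℝ) I (F ∘ γ) (U ∩ γ ⁻¹' S i) t (A.comp γ') :=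
      hA.comp t (hγ.mono inter_subset_left) inter_subset_right
    have h2 := h1.eventually_riemannianEDist_le ((hA' _).trans_lt hδ)
    rw [eventually_nhdsWithin_iff] at h2 ⊢
    filter_upwards [h2] with s hs hsU _ hsi
    exact hs ⟨hsU, hsi⟩
  filter_upwards [key, hγ.1.eventually (hS (γ t))] with s hs ⟨i, hi, hi'⟩
  exact hs i hi hi'

variable [IsManifold J 1 N] [IsContinuousRiemannianBundle E' (fun x : N => TangentSpace J x)]

/-- A map which is differentiable along each of finitely many pieces of its domain, with derivatives
not increasing norms, does not increase the Riemannian distance. -/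
lemma riemannianEDist_le_of_piecewise_norm_le
    (hF : ∀ i, ∀ x ∈ S i, ∃ A : TangentSpace J x →L[ℝ] TangentSpace I (F x),
      HasMFDerivWithinAt J I F (S i) x A ∧ ∀ v, ‖A v‖ ≤ ‖v‖)
    (hS : ∀ x, ∀ᶠ y in 𝓝 x, ∃ i, x ∈ S i ∧ y ∈ S i) (x y : N) :
    riemannianEDist I (F x) (F y) ≤ riemannianEDist J x y := by
  refine le_of_forall_gt fun r hr => ?_
  obtain ⟨γ, rfl, rfl, γ_smooth, hγ⟩ := exists_lt_of_riemannianEDist_lt hr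
  refine lt_of_le_of_lt ?_ hγ
  have hderiv : ∀ t ∈ Icc (0 : ℝ) 1,
      HasMFDerivWithinAt 𝓘(ℝ, ℝ) J γ (Icc 0 1) t (mfderiv[Icc 0 1] γ t) := fun t ht =>
    (γ_smooth.mdifferentiableOn one_ne_zero t ht).hasMFDerivWithinAt
  refine ENNReal.le_of_forall_pos_le_add fun ε ε_pos _ => ?_
  have hε : (0 : ℝ) < ε := ε_pos
  -- The slack `ε * s` grows with time, so that each step of the continuous induction may spend `ε`
  -- per unit of time.
  let Z : Set ℝ := {s | riemannianEDist I (F (γ 0)) (F (γ s)) ≤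
    pathELength J γ 0 s + ENNReal.ofReal (ε * s)}
  suffices h : Icc 0 1 ⊆ Z by simpa [Z] using h (right_mem_Icc.2 zero_le_one)
  have hclosed : IsClosed (Z ∩ Icc 0 1) := by
    refine isClosed_of_closure_subset fun t ht => ?_
    have htI : t ∈ Icc (0 : ℝ) 1 := closure_minimal inter_subset_right isClosed_Icc ht
    refine ⟨?_, htI⟩
    obtain ⟨δ, hδ⟩ := exists_gt ‖mfderiv[Icc 0 1] γ t (1 : ℝ)‖
    have hfreq : ∃ᶠ s in 𝓝[Icc 0 1] t, s ∈ Z := by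
      rw [mem_closure_iff_frequently] at ht
      rw [frequently_nhdsWithin_iff]
      exact ht
    -- The bound at `s ∈ Z` passes to `t`: the length and displacement between `s` and `t` are at
    -- most `δ * |s - t|`, which tends to `0`.
    have hlim : Tendsto (fun s : ℝ => pathELength J γ 0 t +
        ENNReal.ofReal δ * ENNReal.ofReal (s - t) + ENNReal.ofReal (ε * s) +
        ENNReal.ofReal (δ * |s - t|)) (𝓝[Icc 0 1] t)
        (𝓝 (pathELength J γ 0 t + ENNReal.ofReal (ε * t))) := by
      have h1 : Tendsto (fun s : ℝ => ENNReal.ofReal δ * ENNReal.ofReal (s - t)) (𝓝 t) (𝓝 0) := by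
        have : Continuous fun s : ℝ => ENNReal.ofReal δ * ENNReal.ofReal (s - t) :=
          (ENNReal.continuous_const_mul ENNReal.ofReal_ne_top).comp
            (ENNReal.continuous_ofReal.comp (by fun_prop))
        simpa using this.tendsto t
      have h2 : Tendsto (fun s : ℝ => ENNReal.ofReal (ε * s)) (𝓝 t)
          (𝓝 (ENNReal.ofReal (ε * t))) :=
        (ENNReal.continuous_ofReal.comp (by fun_prop : Continuous fun s : ℝ => ε * s)).tendsto t
      have h3 : Tendsto (fun s : ℝ => ENNReal.ofReal (δ * |s - t|)) (𝓝 t) (𝓝 0) := by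
        have : Continuous fun s : ℝ => ENNReal.ofReal (δ * |s - t|) :=
          ENNReal.continuous_ofReal.comp (by fun_prop)
        simpa using this.tendsto t
      have := (((tendsto_const_nhds (x := pathELength J γ 0 t)).add h1).add h2).add h3
      simp only [add_zero] at this
      exact this.mono_left nhdsWithin_le_nhds
    refine ge_of_tendsto_of_frequently hlim ?_
    refine (hfreq.and_eventually (((γ_smooth.eventually_pathELength_le zero_lt_one htI hδ).and
      (eventually_riemannianEDist_comp_le hF hS (hderiv t htI) hδ)).and
      self_mem_nhdsWithin)).mono ?_
    rintro s ⟨hsZ, ⟨hs1, hs2⟩, hs⟩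
    -- The points `s` may approach `t` from either side; from the left, monotonicity of the length
    -- suffices.
    have hlen : pathELength J γ 0 s ≤
        pathELength J γ 0 t + ENNReal.ofReal δ * ENNReal.ofReal (s - t) := by
      rcases le_total s t with hst | hst
      · exact (pathELength_mono le_rfl hst).trans le_self_add
      · rw [← pathELength_add htI.1 hst]
        gcongr
    calc riemannianEDist I (F (γ 0)) (F (γ t))
        ≤ riemannianEDist I (F (γ 0)) (F (γ s)) + riemannianEDist I (F (γ s)) (F (γ t)) :=
          riemannianEDist_triangle
      _ ≤ _ := by
          rw [riemannianEDist_comm (x := F (γ s))]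
          exact add_le_add (hsZ.trans (by gcongr)) hs2
  refine hclosed.Icc_subset_of_forall_mem_nhdsWithin (by simp [Z, riemannianEDist_self]) ?_
  rintro t ⟨htZ, ht⟩
  have htI : t ∈ Icc (0 : ℝ) 1 := ⟨ht.1, ht.2.le⟩
  set v := ‖mfderiv[Icc 0 1] γ t (1 : ℝ)‖
  have hfilter : 𝓝[>] t ≤ 𝓝[Icc 0 1] t :=
    nhdsWithin_le_of_mem (mem_of_superset (Ioc_mem_nhdsGT ht.2)
      fun s hs => ⟨ht.1.trans hs.1.le, hs.2⟩)
  -- Just after `t` the length grows at rate at least `v - ε / 2` and the image moves at rate at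
  -- most `v + ε / 2`; the gap is exactly the rate `ε` of the slack. If `v - ε / 2` is negative,
  -- `ENNReal.ofReal` truncates it to `0`, which is harmless.
  filter_upwards [hfilter (γ_smooth.eventually_le_pathELength zero_lt_one htI
      (δ := v - ε / 2) (by linarith)),
    hfilter (eventually_riemannianEDist_comp_le hF hS (hderiv t htI) (δ := v + ε / 2)
      (lt_add_of_pos_right _ (by positivity))), self_mem_nhdsWithin] with s hs1 hs2 hs
  have hts : 0 ≤ s - t := sub_nonneg.2 (mem_Ioi.1 hs).le
  calc riemannianEDist I (F (γ 0)) (F (γ s))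
      ≤ riemannianEDist I (F (γ 0)) (F (γ t)) + riemannianEDist I (F (γ t)) (F (γ s)) :=
        riemannianEDist_triangle
    _ ≤ (pathELength J γ 0 t + ENNReal.ofReal (ε * t)) +
          ENNReal.ofReal ((v + ε / 2) * |s - t|) := add_le_add htZ hs2
    _ ≤ (pathELength J γ 0 t + ENNReal.ofReal (ε * t)) +
          (pathELength J γ t s + ENNReal.ofReal (ε * (s - t))) := by
        gcongr
        rw [abs_of_nonneg hts,
          show (v + ε / 2) * (s - t) = (v - ε / 2) * (s - t) + ε * (s - t) by ring]
        refine ENNReal.ofReal_add_le.trans ?_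
        gcongr
        rwa [ENNReal.ofReal_mul' hts]
    _ = pathELength J γ 0 s + ENNReal.ofReal (ε * s) := by
        rw [← pathELength_add ht.1 (mem_Ioi.1 hs).le,
          show (ε : ℝ) * s = ε * t + ε * (s - t) by ring,
          ENNReal.ofReal_add (mul_nonneg hε.le ht.1) (mul_nonneg hε.le hts)]
        ring

end Lipschitz

end RiemannianDistanceCurves

/-! ### Charts of the double, the inclusions and the fold map. -/

section DoubleCharts

lemma OpenPartialHomeomorph.extend_apply_zero_nonneg {n : ℕ} [NeZero n] {M : Type*}
    [TopologicalSpace M] (φ : OpenPartialHomeomorph M (EuclideanHalfSpace n)) (p : M) :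
    0 ≤ φ.extend (𝓡∂ n) p 0 :=
  (φ p).2

variable {n : ℕ} [NeZero n] {M : Type*} [TopologicalSpace M]
  [ChartedSpace (EuclideanHalfSpace n) M]

namespace Double

lemma incl_eq_incl_iff {k l : Bool} {p q : M} :
    (incl k p : Double n M) = incl l q ↔ p = q ∧ (k = l ∨ p ∈ (𝓡∂ n).boundary M) :=
  Quotient.eq (r := doubleSetoid n M)

lemma exists_incl_eq (x : Double n M) : ∃ k p, incl k p = x := by
  obtain ⟨⟨k, p⟩, rfl⟩ := Quotient.exists_rep x
  exact ⟨k, p, rfl⟩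

lemma incl_mem_image_incl {k l : Bool} {p : M} {s : Set M} :
    (incl k p : Double n M) ∈ incl l '' s ↔ p ∈ s ∧ (k = l ∨ p ∈ (𝓡∂ n).boundary M) := by
  constructor
  · rintro ⟨q, hq, h⟩
    obtain ⟨rfl, h'⟩ := incl_eq_incl_iff.1 h
    exact ⟨hq, h'.imp_left Eq.symm⟩
  · rintro ⟨hp, h⟩
    exact ⟨p, hp, (incl_eq_incl_iff.2 ⟨rfl, h⟩).symm⟩

/-- The fold map of the double. -/
def fold : Double n M → M :=
  Quotient.lift Prod.snd fun _ _ h => h.1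

@[simp] lemma fold_incl (k : Bool) (p : M) : fold (incl k p : Double n M) = p := rfl

end Double

/-- The reflection of `ℝⁿ` in the first coordinate as a continuous linear equivalence. -/
noncomputable def reflectFirstCLE (n : ℕ) [NeZero n] :
    EuclideanSpace ℝ (Fin n) ≃L[ℝ] EuclideanSpace ℝ (Fin n) :=
  LinearEquiv.toContinuousLinearEquiv
    { toFun := reflectFirst
      invFun := reflectFirst
      map_add' := fun x y => by
        ext i
        by_cases h : i = 0
        · subst h; simp [reflectFirst, setFirst]; ring
        · simp [reflectFirst, setFirst, h]
      map_smul' := fun c x => by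
        ext i
        by_cases h : i = 0
        · subst h; simp [reflectFirst, setFirst]
        · simp [reflectFirst, setFirst, h]
      left_inv := fun x => by
        ext i
        simp [reflectFirst, setFirst]
      right_inv := fun x => by
        ext i
        simp [reflectFirst, setFirst] }

@[simp] lemma reflectFirstCLE_apply (x : EuclideanSpace ℝ (Fin n)) :
    reflectFirstCLE n x = reflectFirst x := rfl

@[simp] lemma reflectFirst_apply_zero (x : EuclideanSpace ℝ (Fin n)) :
    reflectFirst x 0 = -x 0 := by
  simp [reflectFirst, setFirst]

lemma reflectFirst_eq_self {x : EuclideanSpace ℝ (Fin n)} (hx : x 0 = 0) :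
    reflectFirst x = x := by
  ext i
  by_cases h : i = 0
  · subst h; simp [reflectFirst, setFirst, hx]
  · simp [reflectFirst, setFirst, h]

variable [IsManifold (𝓡∂ n) ∞ M] {g : SmoothRiemannianMetric (𝓡∂ n) M}
  [ChartedSpace (EuclideanSpace ℝ (Fin n)) (Double n M)]

/-- Around each point, the inclusion of a copy of `M` into its double is a linear isomorphism in
suitable charts. -/
lemma IsGeodesicDouble.exists_charts (h : IsGeodesicDouble g) (k : Bool) (p : M) :
    ∃ φ ∈ IsManifold.maximalAtlas (𝓡∂ n) ∞ M,
    ∃ e ∈ atlas (EuclideanSpace ℝ (Fin n)) (Double n M),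
    ∃ T : EuclideanSpace ℝ (Fin n) ≃L[ℝ] EuclideanSpace ℝ (Fin n),
      p ∈ φ.source ∧ (∀ q, Double.incl k q ∈ e.source ↔ q ∈ φ.source) ∧
      ∀ q ∈ φ.source, e (Double.incl k q) = T (φ.extend (𝓡∂ n) q) := by
  have hp := mem_chart_source (EuclideanSpace ℝ (Fin n)) (Double.incl k p : Double n M)
  have he := chart_mem_atlas (EuclideanSpace ℝ (Fin n)) (Double.incl k p : Double n M)
  generalize chartAt (EuclideanSpace ℝ (Fin n)) (Double.incl k p : Double n M) = e at hp he
  have he' := he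
  rw [h.atlas_eq] at he'
  rcases he' with ⟨l, φ, hφ, hφi, hs, hv⟩ | ⟨φ, ⟨hφ, -⟩, hs, hv⟩
  · rw [hs, Double.incl_mem_image_incl] at hp
    -- The copies share only boundary points, so an interior chart around `incl k p` belongs to the
    -- copy `k`.
    have hb : p ∉ (𝓡∂ n).boundary M := by
      rw [← (𝓡∂ n).compl_interior]
      exact fun hb => hb (hφi hp.1)
    obtain rfl : k = l := hp.2.resolve_right hb
    refine ⟨φ, hφ, e, he, ContinuousLinearEquiv.refl ℝ _, hp.1, fun q => ?_, hv⟩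
    rw [hs, Double.incl_mem_image_incl]
    simp
  · have hsrc : ∀ q, Double.incl k q ∈ e.source ↔ q ∈ φ.source := by
      intro q
      simp only [hs, mem_union, Double.incl_mem_image_incl]
      cases k <;> simp <;> tauto
    cases k
    · exact ⟨φ, hφ, e, he, ContinuousLinearEquiv.refl ℝ _, (hsrc p).1 hp, hsrc,
        fun q hq => (hv q hq).1⟩
    · exact ⟨φ, hφ, e, he, reflectFirstCLE n, (hsrc p).1 hp, hsrc, fun q hq => (hv q hq).2⟩

/-- Each point of the double has a neighbourhood covered by the copies of `M` containing it. -/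
lemma IsGeodesicDouble.eventually_exists_mem_range_incl (h : IsGeodesicDouble g)
    (x : Double n M) : ∀ᶠ y in 𝓝 x, ∃ k : Bool,
      x ∈ range (Double.incl k : M → Double n M) ∧ y ∈ range (Double.incl k : M → Double n M) := by
  have hx := mem_chart_source (EuclideanSpace ℝ (Fin n)) x
  have he := chart_mem_atlas (EuclideanSpace ℝ (Fin n)) x
  generalize chartAt (EuclideanSpace ℝ (Fin n)) x = e at hx he
  rw [h.atlas_eq] at he
  rcases he with ⟨l, φ, -, -, hs, -⟩ | ⟨φ, -, hs, hv⟩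
  · filter_upwards [e.open_source.mem_nhds hx] with y hy
    rw [hs] at hx hy
    exact ⟨l, image_subset_range _ _ hx, image_subset_range _ _ hy⟩
  by_cases hx2 : ∀ k, x ∈ range (Double.incl k : M → Double n M)
  · refine Eventually.of_forall fun y => ?_
    obtain ⟨k, p, rfl⟩ := Double.exists_incl_eq y
    exact ⟨k, hx2 k, mem_range_self p⟩
  obtain ⟨k, p, rfl⟩ := Double.exists_incl_eq x
  have hsrc : ∀ l q, Double.incl l q ∈ e.source ↔ q ∈ φ.source := by
    intro l q
    simp only [hs, mem_union, Double.incl_mem_image_incl]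
    cases l <;> simp <;> tauto
  have hp : p ∈ φ.source := (hsrc k p).1 hx
  -- The reflection fixes the hyperplane, so a vanishing first coordinate would give both copies of
  -- `p` the same image under the injective chart `e`, and `x` would lie in both copies.
  have hne : φ.extend (𝓡∂ n) p 0 ≠ 0 := by
    intro h0
    have heq : (Double.incl false p : Double n M) = Double.incl true p := by
      refine e.injOn ((hsrc _ _).2 hp) ((hsrc _ _).2 hp) ?_
      rw [(hv p hp).1, (hv p hp).2, reflectFirst_eq_self h0]
    refine hx2 fun l => ?_
    cases k <;> cases l
    · exact ⟨p, rfl⟩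
    · exact ⟨p, heq.symm⟩
    · exact ⟨p, heq⟩
    · exact ⟨p, rfl⟩
  have hpos : 0 < φ.extend (𝓡∂ n) p 0 :=
    lt_of_le_of_ne (φ.extend_apply_zero_nonneg p) hne.symm
  have hcont : ContinuousAt (fun y => e y 0) (Double.incl k p) :=
    (EuclideanSpace.proj (𝕜 := ℝ) (0 : Fin n)).continuous.continuousAt.comp (e.continuousAt hx)
  -- In a collar chart the sign of the first coordinate tells the copy, and a non-zero sign persists
  -- nearby.
  have hside : ∀ᶠ y in 𝓝 (Double.incl k p : Double n M), bif k then e y 0 < 0 else 0 < e y 0 := by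
    cases k
    · refine hcont.eventually (lt_mem_nhds ?_)
      simpa only [(hv p hp).1] using hpos
    · refine hcont.eventually (gt_mem_nhds ?_)
      simpa only [(hv p hp).2, reflectFirst_apply_zero, neg_lt_zero] using hpos
  filter_upwards [hside, e.open_source.mem_nhds hx] with y hy hys
  refine ⟨k, mem_range_self p, ?_⟩
  obtain ⟨l, q, rfl⟩ := Double.exists_incl_eq y
  have hq := (hsrc l q).1 hys
  have hq0 := φ.extend_apply_zero_nonneg q
  cases k <;> cases l
  · exact mem_range_self q
  · simp only [(hv q hq).2, reflectFirst_apply_zero, cond_false] at hy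
    linarith
  · simp only [(hv q hq).1, cond_true] at hy
    linarith
  · exact mem_range_self q

namespace IsGeodesicDouble

variable [IsManifold (𝓡 n) ∞ (Double n M)]

lemma mdifferentiable_incl (h : IsGeodesicDouble g) (k : Bool) :
    MDifferentiable (𝓡∂ n) (𝓡 n) (Double.incl k : M → Double n M) := by
  intro p
  obtain ⟨φ, hφ, e, he, T, hp, hs, hv⟩ := h.exists_charts k p
  have hφ1 := IsManifold.maximalAtlas_subset_of_le (m := 1) (I := 𝓡∂ n) (M := M)
    (n := ∞) ENat.LEInfty.out hφ
  have he1 : e ∈ IsManifold.maximalAtlas (𝓡 n) 1 (Double n M) :=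
    IsManifold.subset_maximalAtlas he
  have h1 : MDifferentiableAt (𝓡∂ n) 𝓘(ℝ, EuclideanSpace ℝ (Fin n)) (φ.extend (𝓡∂ n)) p :=
    (𝓡∂ n).mdifferentiableAt.comp p (mdifferentiableAt_of_mem_maximalAtlas hφ1 hp)
  have h2 : MDifferentiableAt (𝓡∂ n) 𝓘(ℝ, EuclideanSpace ℝ (Fin n))
      (fun q => T (φ.extend (𝓡∂ n) q)) p :=
    T.differentiableAt.mdifferentiableAt.comp p h1
  have hT : T (φ.extend (𝓡∂ n) p) ∈ e.target := by
    rw [← hv p hp]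
    exact e.map_source ((hs p).2 hp)
  have h3 : MDifferentiableAt (𝓡∂ n) (𝓡 n) (fun q => e.symm (T (φ.extend (𝓡∂ n) q))) p :=
    (mdifferentiableAt_symm_of_mem_maximalAtlas he1 hT).comp p h2
  refine h3.congr_of_eventuallyEq ?_
  filter_upwards [φ.open_source.mem_nhds hp] with q hq
  rw [← hv q hq, e.left_inv ((hs q).2 hq)]

/-- Along copy `k` the fold map is `φ⁻¹ ∘ T⁻¹ ∘ e`. At a boundary point this fails across the
boundary, where the other copy is read with a different `T`. -/
lemma mdifferentiableWithinAt_fold (h : IsGeodesicDouble g) (k : Bool) (p : M) :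
    MDifferentiableWithinAt (𝓡 n) (𝓡∂ n) (Double.fold : Double n M → M)
      (range (Double.incl k)) (Double.incl k p) := by
  obtain ⟨φ, hφ, e, he, T, hp, hs, hv⟩ := h.exists_charts k p
  have hφ1 := IsManifold.maximalAtlas_subset_of_le (m := 1) (I := 𝓡∂ n) (M := M)
    (n := ∞) ENat.LEInfty.out hφ
  have he1 : e ∈ IsManifold.maximalAtlas (𝓡 n) 1 (Double n M) :=
    IsManifold.subset_maximalAtlas he
  set S : Set (Double n M) := range (Double.incl k) ∩ e.source
  have hpS : Double.incl k p ∈ e.source := (hs p).2 hp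
  have hval : T.symm (e (Double.incl k p)) = φ.extend (𝓡∂ n) p := by simp [hv p hp]
  have h1 : MDifferentiableWithinAt (𝓡 n) 𝓘(ℝ, EuclideanSpace ℝ (Fin n))
      (fun x => T.symm (e x)) S (Double.incl k p) :=
    (T.symm.differentiableAt.mdifferentiableAt.comp (Double.incl k p)
      (mdifferentiableAt_of_mem_maximalAtlas he1 hpS)).mdifferentiableWithinAt
  have h2 : MDifferentiableWithinAt (𝓡 n) (𝓡∂ n)
      (fun x => (𝓡∂ n).symm (T.symm (e x))) S (Double.incl k p) := by
    -- The inverse of the half-space model is differentiable only within its range, so it matters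
    -- that `T⁻¹ ∘ e` maps copy `k` into the half-space.
    refine MDifferentiableWithinAt.comp (Double.incl k p) (u := range (𝓡∂ n)) ?_ h1 ?_
    · apply (𝓡∂ n).mdifferentiableWithinAt_symm
      rw [hval]
      exact mem_range_self _
    · rintro _ ⟨⟨q, rfl⟩, hq⟩
      have hq' := (hs q).1 hq
      simp [hv q hq']
  have hval' : (𝓡∂ n).symm (T.symm (e (Double.incl k p))) = φ p := by
    rw [hval]
    exact (𝓡∂ n).left_inv (φ p)
  have h3 : MDifferentiableWithinAt (𝓡 n) (𝓡∂ n)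
      (fun x => φ.symm ((𝓡∂ n).symm (T.symm (e x)))) S (Double.incl k p) := by
    refine MDifferentiableAt.comp_mdifferentiableWithinAt (Double.incl k p) ?_ h2
    apply mdifferentiableAt_symm_of_mem_maximalAtlas hφ1
    rw [hval']
    exact φ.map_source hp
  have hfold : ∀ x ∈ S, Double.fold x = φ.symm ((𝓡∂ n).symm (T.symm (e x))) := by
    rintro _ ⟨⟨q, rfl⟩, hq⟩
    have hq' := (hs q).1 hq
    have hq0 : (𝓡∂ n).symm (φ.extend (𝓡∂ n) q) = φ q := (𝓡∂ n).left_inv (φ q)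
    rw [hv q hq', T.symm_apply_apply, hq0, φ.left_inv hq', Double.fold_incl]
  exact (h3.congr hfold (hfold _ ⟨mem_range_self p, hpS⟩)).mono_of_mem_nhdsWithin
    (inter_mem self_mem_nhdsWithin (mem_nhdsWithin_of_mem_nhds (e.open_source.mem_nhds hpS)))

/-- The derivative of the fold map along a copy of `M` is inverse to that of the inclusion. -/
lemma exists_hasMFDerivWithinAt_fold (h : IsGeodesicDouble g) (k : Bool) (p : M) :
    ∃ A : TangentSpace (𝓡 n) (Double.incl k p : Double n M) →L[ℝ] TangentSpace (𝓡∂ n) p,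
      HasMFDerivWithinAt (𝓡 n) (𝓡∂ n) (Double.fold : Double n M → M)
        (range (Double.incl k)) (Double.incl k p) A ∧
      ∀ v, mfderiv (𝓡∂ n) (𝓡 n) (Double.incl k : M → Double n M) p (A v) = v := by
  refine ⟨_, (h.mdifferentiableWithinAt_fold k p).hasMFDerivWithinAt, ?_⟩
  have hA := (h.mdifferentiableWithinAt_fold k p).hasMFDerivWithinAt
  set A := mfderivWithin (𝓡 n) (𝓡∂ n) (Double.fold : Double n M → M)
    (range (Double.incl k)) (Double.incl k p)
  have hD := (h.mdifferentiable_incl k p).hasMFDerivAt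
  set D := mfderiv (𝓡∂ n) (𝓡 n) (Double.incl k : M → Double n M) p
  have h1 : HasMFDerivAt (𝓡∂ n) (𝓡∂ n) (Double.fold ∘ (Double.incl k : M → Double n M)) p
      (A.comp D) := by
    rw [← hasMFDerivWithinAt_univ] at hD ⊢
    exact hA.comp p hD fun q _ => mem_range_self q
  have h2 : A.comp D = ContinuousLinearMap.id ℝ (TangentSpace (𝓡∂ n) p) :=
    hasMFDerivAt_unique h1 (hasMFDerivAt_id p)
  let A' : EuclideanSpace ℝ (Fin n) →ₗ[ℝ] EuclideanSpace ℝ (Fin n) := A.toLinearMap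
  let D' : EuclideanSpace ℝ (Fin n) →ₗ[ℝ] EuclideanSpace ℝ (Fin n) := D.toLinearMap
  have h3 : A' * D' = 1 := by
    ext1 v
    exact congr($h2 v)
  -- `fold ∘ incl k = id` gives a left inverse only; both tangent spaces are modelled on the same
  -- finite-dimensional space, so it is two-sided.
  have h4 : D' * A' = 1 := mul_eq_one_comm.1 h3
  exact fun v => congr($h4 v)

end IsGeodesicDouble

end DoubleCharts

/-! ### The distance comparison for smooth metrics. -/

namespace SmoothRiemannianMetric

variable {E H M : Type*} [NormedAddCommGroup E] [NormedSpace ℝ E] [TopologicalSpace H]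
  {I : ModelWithCorners ℝ E H} [TopologicalSpace M] [ChartedSpace H M] [IsManifold I ∞ M]

lemma riemDist_triangle (g : SmoothRiemannianMetric I M) (x y z : M) :
    g.riemDist x z ≤ g.riemDist x y + g.riemDist y z :=
  letI : RiemannianBundle (fun x : M => TangentSpace I x) := ⟨g.toRiemannianMetric⟩
  riemannianEDist_triangle

variable {E' H' N : Type*} [NormedAddCommGroup E'] [NormedSpace ℝ E'] [TopologicalSpace H']
  {J : ModelWithCorners ℝ E' H'} [TopologicalSpace N] [ChartedSpace H' N] [IsManifold J ∞ N]

/-- A map which is differentiable along each of finitely many pieces of its domain, with derivatives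
not increasing the metric, does not increase the Riemannian distance. -/
lemma riemDist_le_of_piecewise_inner_le (g : SmoothRiemannianMetric I M)
    (G : SmoothRiemannianMetric J N) {ι : Type*} [Finite ι] {S : ι → Set N} {F : N → M}
    (hF : ∀ i, ∀ x ∈ S i, ∃ A : TangentSpace J x →L[ℝ] TangentSpace I (F x),
      HasMFDerivWithinAt J I F (S i) x A ∧ ∀ v, g.inner (F x) (A v) (A v) ≤ G.inner x v v)
    (hS : ∀ x, ∀ᶠ y in 𝓝 x, ∃ i, x ∈ S i ∧ y ∈ S i) (x y : N) :
    g.riemDist (F x) (F y) ≤ G.riemDist x y := by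
  let : RiemannianBundle (fun x : M => TangentSpace I x) := ⟨g.toRiemannianMetric⟩
  let : RiemannianBundle (fun x : N => TangentSpace J x) := ⟨G.toRiemannianMetric⟩
  have : IsContinuousRiemannianBundle E (fun x : M => TangentSpace I x) :=
    ⟨g.inner, g.contMDiff.continuous, fun _ _ _ => rfl⟩
  have : IsContinuousRiemannianBundle E' (fun x : N => TangentSpace J x) :=
    ⟨G.inner, G.contMDiff.continuous, fun _ _ _ => rfl⟩
  refine riemannianEDist_le_of_piecewise_norm_le (fun i x hx => ?_) hS x y
  obtain ⟨A, hA, hA'⟩ := hF i x hx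
  refine ⟨A, hA, fun v => ?_⟩
  rw [norm_eq_sqrt_real_inner, norm_eq_sqrt_real_inner]
  exact Real.sqrt_le_sqrt (hA' v)

end SmoothRiemannianMetric

/-! ### Distances, uniqueness and completeness for the twofold copy. -/

section TwofoldCopy

variable {n : ℕ} [NeZero n] {M : Type*} [TopologicalSpace M]
  [ChartedSpace (EuclideanHalfSpace n) M] [IsManifold (𝓡∂ n) ∞ M]
  {g : SmoothRiemannianMetric (𝓡∂ n) M}
  [ChartedSpace (EuclideanSpace ℝ (Fin n)) (Double n M)] [IsManifold (𝓡 n) ∞ (Double n M)]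
  {G G' : SmoothRiemannianMetric (𝓡 n) (Double n M)}

namespace IsTwofoldCopy

lemma riemDist_incl_le (hG : IsTwofoldCopy g G) (h : IsGeodesicDouble g) (k : Bool) (p q : M) :
    G.riemDist (Double.incl k p) (Double.incl k q) ≤ g.riemDist p q := by
  refine G.riemDist_le_of_piecewise_inner_le g (ι := Unit) (S := fun _ => univ)
    (fun _ p _ => ⟨_, (h.mdifferentiable_incl k p).hasMFDerivAt.hasMFDerivWithinAt,
      fun v => (hG k p v v).le⟩) (fun _ => ?_) p q
  simp

/-- The two copies are the pieces. On each, the derivative of the fold map inverts that of the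
isometric inclusion, so it preserves the metric. -/
lemma riemDist_fold_le (hG : IsTwofoldCopy g G) (h : IsGeodesicDouble g) (x y : Double n M) :
    g.riemDist x.fold y.fold ≤ G.riemDist x y := by
  refine g.riemDist_le_of_piecewise_inner_le G
    (S := fun k : Bool => range (Double.incl k : M → Double n M)) ?_
    h.eventually_exists_mem_range_incl x y
  rintro k _ ⟨p, rfl⟩
  obtain ⟨A, hA, hA'⟩ := h.exists_hasMFDerivWithinAt_fold k p
  refine ⟨A, hA, fun v => ?_⟩
  have := hG k p (A v) (A v)
  rw [hA'] at this
  exact this.ge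

/-- Every tangent vector of the double is the image `D (A v)` of a vector tangent to `M`, so `g`
determines all values of the metric. -/
lemma eq_of_isTwofoldCopy (hG : IsTwofoldCopy g G) (hG' : IsTwofoldCopy g G')
    (h : IsGeodesicDouble g) : G' = G := by
  have hinner : G'.inner = G.inner := by
    funext x
    obtain ⟨k, p, rfl⟩ := Double.exists_incl_eq x
    obtain ⟨A, -, hA⟩ := h.exists_hasMFDerivWithinAt_fold k p
    ext v w
    have h1 := hG k p (A v) (A w)
    have h2 := hG' k p (A v) (A w)
    rw [hA, hA] at h1 h2
    exact h2.trans h1.symm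
  cases G
  cases G'
  cases hinner
  rfl

/-- The twofold copy of a complete metric is complete. -/
lemma isComplete (hG : IsTwofoldCopy g G) (h : IsGeodesicDouble g) (hg : g.IsComplete) :
    G.IsComplete := by
  intro u hu
  obtain ⟨p, hp⟩ := hg (fun i => (u i).fold) fun ε hε => by
    obtain ⟨N, hN⟩ := hu ε hε
    exact ⟨N, fun k hk l hl => (hG.riemDist_fold_le h _ _).trans_lt (hN k hk l hl)⟩
  -- Pigeonhole on the two copies; this `k` selects which copy of `p` is the limit.
  obtain ⟨k, hk⟩ : ∃ k : Bool, ∃ᶠ i in atTop, ∃ q, Double.incl k q = u i := by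
    rw [← frequently_exists]
    exact Frequently.of_forall fun i => Double.exists_incl_eq (u i)
  refine ⟨Double.incl k p, ENNReal.tendsto_nhds_zero.2 fun ε hε => ?_⟩
  have hε2 : 0 < ε / 2 := ENNReal.half_pos hε.ne'
  obtain ⟨N, hN⟩ := hu (ε / 2) hε2
  -- A single term suffices: `u m` lies in copy `k`, has its fold within `ε / 2` of `p`, and comes
  -- late enough for the Cauchy bound.
  obtain ⟨m, ⟨⟨q, hq⟩, hm⟩, hmN⟩ := ((hk.and_eventually
    (ENNReal.tendsto_nhds_zero.1 hp (ε / 2) hε2)).and_eventually (eventually_ge_atTop N)).exists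
  filter_upwards [eventually_ge_atTop N] with i hi
  calc G.riemDist (u i) (Double.incl k p)
      ≤ G.riemDist (u i) (u m) + G.riemDist (u m) (Double.incl k p) := G.riemDist_triangle _ _ _
    _ ≤ ε / 2 + ε / 2 := by
        refine add_le_add (hN i hi m hmN).le ?_
        rw [← hq] at hm ⊢
        exact (hG.riemDist_incl_le h k q p).trans hm
    _ = ε := ENNReal.add_halves ε

end IsTwofoldCopy

end TwofoldCopy

theorem theorem2p2 {n : ℕ} [NeZero n] {M : Type*} [TopologicalSpace M] [T2Space M]
    [SecondCountableTopology M] [ConnectedSpace M]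
    [ChartedSpace (EuclideanHalfSpace n) M] [IsManifold (𝓡∂ n) ∞ M]
    (hboundary : ((𝓡∂ n).boundary M).Nonempty)
    (g : SmoothRiemannianMetric (𝓡∂ n) M) (hcomplete : g.IsComplete)
    [ChartedSpace (EuclideanSpace ℝ (Fin n)) (Double n M)] [IsManifold (𝓡 n) ∞ (Double n M)]
    (hdouble : IsGeodesicDouble g) (hdoubling : IsDoublingMetric g) :
    ∃ G : SmoothRiemannianMetric (𝓡 n) (Double n M),
      IsTwofoldCopy g G ∧ (∀ G', IsTwofoldCopy g G' → G' = G) ∧ G.IsComplete := by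
  obtain ⟨G, hG⟩ := hdoubling
  exact ⟨G, hG, fun G' hG' => hG.eq_of_isTwofoldCopy hG' hdouble, hG.isComplete hdouble hcomplete⟩
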